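/- A nearest neighbor representation of a Boolean function $f:\{0,1\}^m\to\{0,1\}$ is a pair of disjoint finite sets $P,N\subset\mathbb R^m$ (the positive and negative prototypes) such that for every $a\in\{0,1\}^m$: if $f(a)=1$ then there is $b\in P$ with $d(a,b)<d(a,c)$ for all $c\in N$, and if $f(a)=0$ then there is $b\in N$ with $d(a,b)<d(a,c)$ for all $c\in P$, where $d$ is the Euclidean distance. Its size is $|P\cup N|$, and $NN(f)$ denotes the minimum size of a nearest neighbor representation of $f$. Let $IP_n(x_1,\dots,x_n,y_1,\dots,y_n)=(x_1\wedge y_1)\oplus\cdots\oplus(x_n\wedge y_n)$ be the mod 2 inner product function of $2n$ variables. Then for every $n$: (a) $NN(IP_n)\ge 2^{n/2}$. (b) $NN(x_1\oplus\cdots\oplus x_n)\ge n+1$. This bound is tight: $NN(x_1\oplus\cdots\oplus x_n)\le n+1$, so $NN(x_1\oplus\cdots\oplus x_n)=n+1$. -/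

import Mathlib

/-- The point of `ℝ^ι` (with the Euclidean norm) given by a truth assignment `a ∈ {0,1}^ι`. -/
def cubePoint {ι : Type} (a : ι → Bool) : EuclideanSpace ℝ ι :=
  WithLp.toLp 2 (fun i => if a i then (1 : ℝ) else 0)

/-- `(P, N)` is a nearest neighbor representation of the Boolean function `f` (with variables
indexed by `ι`): `P` (positive prototypes) and `N` (negative prototypes) are disjoint sets of
points in Euclidean space; every positive `a` has a positive prototype strictly closer than
all negative ones, and every negative `a` has a negative prototype strictly closer than all
positive ones. -/
structure IsNNRepresentation {ι : Type} [Fintype ι] (f : (ι → Bool) → Bool)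
    (P N : Set (EuclideanSpace ℝ ι)) : Prop where
  disjoint : Disjoint P N
  positive : ∀ a, f a = true →
    ∃ b ∈ P, ∀ c ∈ N, dist (cubePoint a) b < dist (cubePoint a) c
  negative : ∀ a, f a = false →
    ∃ b ∈ N, ∀ c ∈ P, dist (cubePoint a) b < dist (cubePoint a) c

/-- The sizes `|P ∪ N|` of the (finite) nearest neighbor representations of `f`. -/
def nnSizes {ι : Type} [Fintype ι] (f : (ι → Bool) → Bool) : Set ℕ :=
  {m | ∃ P N : Set (EuclideanSpace ℝ ι), P.Finite ∧ N.Finite ∧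
    IsNNRepresentation f P N ∧ (P ∪ N).ncard = m}

/-- The nearest neighbor complexity of `f`: the least size of a representation. The infimum is
over a nonempty set of natural numbers (`nnSizes_nonempty`), hence a minimum. -/
noncomputable def nnComplexity {ι : Type} [Fintype ι] (f : (ι → Bool) → Bool) : ℕ :=
  sInf (nnSizes f)

theorem cubePoint_injective {ι : Type} :
    Function.Injective (cubePoint : (ι → Bool) → EuclideanSpace ℝ ι) := by
  intro a b h
  funext i
  have hi : (cubePoint a) i = (cubePoint b) i := by rw [h]
  simp only [cubePoint] at hi
  cases ha : a i <;> cases hb : b i <;> simp [ha, hb] at hi ⊢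

/-- Every Boolean function has a representation: take all truth assignments as prototypes. -/
theorem nnSizes_nonempty {ι : Type} [Fintype ι] (f : (ι → Bool) → Bool) :
    (nnSizes f).Nonempty := by
  refine ⟨_, cubePoint '' {a | f a = true}, cubePoint '' {a | f a = false},
    Set.toFinite _, Set.toFinite _, ⟨?_, ?_, ?_⟩, rfl⟩
  · rw [Set.disjoint_left]
    rintro _ ⟨a, ha, rfl⟩ ⟨b, hb, hab⟩
    have : b = a := cubePoint_injective hab
    simp_all
  · intro a ha
    refine ⟨_, ⟨a, ha, rfl⟩, ?_⟩
    rintro _ ⟨b, hb, rfl⟩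
    rw [dist_self, dist_pos]
    intro hab
    have : a = b := cubePoint_injective hab
    simp_all
  · intro a ha
    refine ⟨_, ⟨a, ha, rfl⟩, ?_⟩
    rintro _ ⟨b, hb, rfl⟩
    rw [dist_self, dist_pos]
    intro hab
    have : a = b := cubePoint_injective hab
    simp_all

/-- Parity: `x_1 ⊕ ⋯ ⊕ x_n`. -/
def parityFn (n : ℕ) (x : Fin n → Bool) : Bool :=
  (List.ofFn x).foldr xor false

/-- The mod 2 inner product function `(x_1 ∧ y_1) ⊕ ⋯ ⊕ (x_n ∧ y_n)` of the `2n` variables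
`x_i = z (Sum.inl i)`, `y_i = z (Sum.inr i)`. -/
def innerProductFn (n : ℕ) (z : Fin n ⊕ Fin n → Bool) : Bool :=
  (List.ofFn (fun i : Fin n => z (Sum.inl i) && z (Sum.inr i))).foldr xor false

/-!
Both lower bounds rest on replacing nearest neighbors by a sum of Gaussians. For a prototype `b`
the weight `a ↦ exp (-K * dist a b ^ 2)` is positive and is a product of functions of the single
coordinates of `a`. When `K` is large, the total weight of the prototypes of the wrong class is
negligible, so that the signed sum of the weights has the sign prescribed by `f` and almost the
size of the unsigned sum (`IsNNRepresentation.exists_product_weights`).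

*Parity.* Integrate the signed sum against parity times a positive product measure. The integral
is positive; on the other hand it is a sum over the prototypes `b` of products over the coordinates
`i`, and the `i`-th measure can be chosen to annihilate the `i`-th factor of one prototype. With at
most `n` prototypes all terms vanish, a contradiction (`card_gt_of_parity_weights`). Conversely,
the `n + 1` points `(k / n, …, k / n)` work: a vertex with `k` ones is nearest to the `k`-th.

*Inner product.* Splitting the variables into `x` and `y`, each weight becomes a positive matrix
`p b x * q b y` of rank one, so the sign matrix `M` of the function is almost the sign pattern, in
the strong sense above, of a matrix of rank `m`. The argument is Forster's, except that positivity
of the weights lets diagonal scaling (`exists_scaling`) take the place of his isotropic position: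
one may assume that `∑ b, p b x ^ 2 = 1` and `∑ b, q b y ^ 2 = 1`, and that `∑ x, p b x ^ 2` does
not depend on `b`. Then `∑ x y b, p b x * q b y` is at least `|X| |Y| / m` as all entries are at
most one, while it is at most about `‖M‖ √(|X| |Y|)`, whence `√(|X| |Y|) ≤ m ‖M‖`. Here
`‖M‖ ^ 2 = 2 ^ n`, because the columns of `M` are orthogonal.
-/

open Finset Filter Topology

/-! ### Signs of Boolean functions -/

/-- The sign `(-1) ^ b` of a Boolean `b`. -/
def boolSign (b : Bool) : ℝ := if b then -1 else 1

lemma boolSign_mul_self (b : Bool) : boolSign b * boolSign b = 1 := by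
  cases b <;> simp [boolSign]

lemma boolSign_foldr_xor (l : List Bool) :
    boolSign (l.foldr xor false) = (l.map boolSign).prod := by
  induction l with
  | nil => simp [boolSign]
  | cons a l ih =>
    rw [List.foldr_cons, List.map_cons, List.prod_cons, ← ih]
    cases a <;> cases (List.foldr xor false l) <;> simp [boolSign]

lemma boolSign_parityFn {n : ℕ} (x : Fin n → Bool) :
    boolSign (parityFn n x) = ∏ i, boolSign (x i) := by
  rw [parityFn, boolSign_foldr_xor, List.map_ofFn, List.prod_ofFn]
  rfl

lemma boolSign_innerProductFn {n : ℕ} (z : Fin n ⊕ Fin n → Bool) :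
    boolSign (innerProductFn n z) = ∏ i, boolSign (z (Sum.inl i) && z (Sum.inr i)) := by
  rw [innerProductFn, boolSign_foldr_xor, List.map_ofFn, List.prod_ofFn]
  rfl

lemma sum_bool_prod {n : ℕ} (g : Fin n → Bool → ℝ) :
    ∑ x : Fin n → Bool, ∏ i, g i (x i) = ∏ i, (g i true + g i false) := by
  simpa only [Fintype.piFinset_univ, Fintype.sum_bool] using
    (Finset.prod_univ_sum (fun _ : Fin n => (univ : Finset Bool)) g).symm

/-! ### From nearest neighbors to product weights -/

lemma exp_neg_mul_dist_sq {ι : Type} [Fintype ι] (K : ℝ) (a : ι → Bool)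
    (b : EuclideanSpace ℝ ι) :
    Real.exp (-K * dist (cubePoint a) b ^ 2) =
      ∏ i, Real.exp (-K * ((if a i then (1 : ℝ) else 0) - b i) ^ 2) := by
  rw [EuclideanSpace.dist_sq_eq, ← Real.exp_sum, Finset.mul_sum]
  simp [cubePoint, Real.dist_eq, sq_abs]

lemma eventually_exp_le {r s η : ℝ} (h : r < s) (hη : 0 < η) :
    ∀ᶠ K : ℝ in atTop, Real.exp (-K * s) ≤ η * Real.exp (-K * r) := by
  filter_upwards [eventually_ge_atTop (-Real.log η / (s - r))] with K hK
  rw [div_le_iff₀ (by linarith)] at hK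
  rw [← Real.exp_log hη, ← Real.exp_add, Real.exp_le_exp]
  linarith

/-- A nearest neighbor representation gives a signed sum of positive product functions, one for
each prototype, which has the sign of `f` and differs little in size from the unsigned sum. -/
lemma IsNNRepresentation.exists_product_weights {ι : Type} [Fintype ι] {f : (ι → Bool) → Bool}
    {P N : Set (EuclideanSpace ℝ ι)} (h : IsNNRepresentation f P N) [Fintype ↥(P ∪ N)]
    {δ : ℝ} (hδ : 0 < δ) :
    ∃ (e : ↥(P ∪ N) → Bool) (g : ↥(P ∪ N) → ι → Bool → ℝ), (∀ b i t, 0 < g b i t) ∧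
      ∀ a, (1 - δ) * ∑ b, ∏ i, g b i (a i) ≤
        boolSign (f a) * ∑ b, boolSign (e b) * ∏ i, g b i (a i) := by
  classical
  set m : ℝ := (Fintype.card ↥(P ∪ N) : ℝ) + 1 with hm
  have hmpos : 0 < m := by positivity
  let e : ↥(P ∪ N) → Bool := fun b => decide (b.1 ∈ P)
  have key : ∀ a, ∃ b : ↥(P ∪ N), ∀ c : ↥(P ∪ N), e c ≠ f a →
      dist (cubePoint a) b.1 < dist (cubePoint a) c.1 := by
    intro a
    cases hf : f a
    · obtain ⟨b, hb, hbc⟩ := h.negative a hf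
      exact ⟨⟨b, Or.inr hb⟩, fun c hc => hbc _ (by simpa [e] using hc)⟩
    · obtain ⟨b, hb, hbc⟩ := h.positive a hf
      refine ⟨⟨b, Or.inl hb⟩, fun c hc => hbc _ ?_⟩
      exact c.2.resolve_left (by simpa [e] using hc)
  choose β hβ using key
  have hev : ∀ᶠ K : ℝ in atTop, ∀ a, ∀ c : ↥(P ∪ N), e c ≠ f a →
      Real.exp (-K * dist (cubePoint a) c.1 ^ 2) ≤
        δ / (2 * m) * Real.exp (-K * dist (cubePoint a) (β a).1 ^ 2) := by
    refine eventually_all.2 fun a => eventually_all.2 fun c => ?_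
    by_cases hc : e c ≠ f a
    · have := hβ a c hc
      filter_upwards [eventually_exp_le (r := dist (cubePoint a) (β a).1 ^ 2)
        (s := dist (cubePoint a) c.1 ^ 2) (by gcongr) (by positivity : 0 < δ / (2 * m))]
        with K hK _ using hK
    · exact Eventually.of_forall fun K hc' => absurd hc' hc
  obtain ⟨K, hK⟩ := hev.exists
  refine ⟨e, fun b i t => Real.exp (-K * ((if t then (1 : ℝ) else 0) - b.1 i) ^ 2),
    fun _ _ _ => Real.exp_pos _, fun a => ?_⟩
  simp only [← exp_neg_mul_dist_sq]
  set w : ↥(P ∪ N) → ℝ := fun b => Real.exp (-K * dist (cubePoint a) b.1 ^ 2) with hw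
  change (1 - δ) * ∑ b, w b ≤ boolSign (f a) * ∑ b, boolSign (e b) * w b
  have hwpos : ∀ b, 0 < w b := fun b => Real.exp_pos _
  have hterm : ∀ b, w b - δ / m * w (β a) ≤ boolSign (f a) * (boolSign (e b) * w b) := by
    intro b
    by_cases hb : e b = f a
    · rw [hb, ← mul_assoc, boolSign_mul_self, one_mul]
      have := hwpos (β a)
      have : 0 ≤ δ / m * w (β a) := by positivity
      linarith
    · have h1 : w b ≤ δ / (2 * m) * w (β a) := hK a b hb
      have h2 : boolSign (f a) * (boolSign (e b) * w b) = -w b := by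
        cases hx : f a <;> cases hy : e b <;> simp_all [boolSign]
      have h3 : δ / m * w (β a) = 2 * (δ / (2 * m) * w (β a)) := by field_simp
      linarith
  have hsum := Finset.sum_le_sum fun b (_ : b ∈ univ) => hterm b
  rw [← Finset.mul_sum, Finset.sum_sub_distrib, Finset.sum_const, Finset.card_univ,
    nsmul_eq_mul] at hsum
  have hle : w (β a) ≤ ∑ b, w b :=
    Finset.single_le_sum (f := w) (fun b _ => (hwpos b).le) (mem_univ _)
  have hcoef : (Fintype.card ↥(P ∪ N) : ℝ) * (δ / m * w (β a)) ≤ δ * w (β a) := by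
    have hc : (Fintype.card ↥(P ∪ N) : ℝ) / m ≤ 1 := by
      rw [div_le_one hmpos]; linarith
    calc _ = (Fintype.card ↥(P ∪ N) : ℝ) / m * (δ * w (β a)) := by ring
      _ ≤ 1 * (δ * w (β a)) :=
        mul_le_mul_of_nonneg_right hc (mul_pos hδ (hwpos _)).le
      _ = _ := one_mul _
  have := mul_le_mul_of_nonneg_left hle hδ.le
  linarith

/-- There is at least one prototype, since the vertex `0` of the cube has a nearest one. -/
lemma IsNNRepresentation.nonempty {ι : Type} [Fintype ι] {f : (ι → Bool) → Bool}
    {P N : Set (EuclideanSpace ℝ ι)} (h : IsNNRepresentation f P N) : Nonempty ↥(P ∪ N) := by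
  cases hf : f (fun _ => false)
  · obtain ⟨b, hb, -⟩ := h.negative _ hf
    exact ⟨⟨b, Or.inr hb⟩⟩
  · obtain ⟨b, hb, -⟩ := h.positive _ hf
    exact ⟨⟨b, Or.inl hb⟩⟩

/-! ### Parity -/

/-- A signed sum of positive product functions with the sign of parity has more than `n` terms:
otherwise a positive product measure twisted by parity integrates each term to zero, one
coordinate being devoted to each. -/
lemma card_gt_of_parity_weights {n : ℕ} {B : Type*} [Fintype B] [Nonempty B] (ε : B → ℝ)
    (g : B → Fin n → Bool → ℝ) (hg : ∀ b i t, 0 < g b i t)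
    (h : ∀ a, 0 < boolSign (parityFn n a) * ∑ b, ε b * ∏ i, g b i (a i)) :
    n < Fintype.card B := by
  by_contra! hcard
  obtain ⟨β, hβ⟩ : ∃ β : Fin n → B, Function.Surjective β :=
    Function.Embedding.nonempty_of_card_le (α := B) (β := Fin n) (by simpa using hcard)
      |>.elim fun φ => ⟨Function.invFun φ, Function.invFun_surjective φ.injective⟩
  -- the density `t ↦ g (β i) i (!t)` annihilates `boolSign t * g (β i) i t`
  have hpos : 0 < ∑ a : Fin n → Bool, (∏ i, g (β i) i (!(a i))) *
      (boolSign (parityFn n a) * ∑ b, ε b * ∏ i, g b i (a i)) :=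
    Finset.sum_pos (fun a _ => mul_pos (Finset.prod_pos fun i _ => hg _ _ _) (h a)) univ_nonempty
  refine hpos.ne' ?_
  simp only [Finset.mul_sum]
  rw [Finset.sum_comm]
  refine Finset.sum_eq_zero fun b _ => ?_
  obtain ⟨j, rfl⟩ := hβ b
  have hrw : ∀ a : Fin n → Bool, (∏ i, g (β i) i (!(a i))) *
      (boolSign (parityFn n a) * (ε (β j) * ∏ i, g (β j) i (a i))) =
      ε (β j) * ∏ i, (g (β i) i (!(a i)) * boolSign (a i) * g (β j) i (a i)) := by
    intro a
    rw [boolSign_parityFn, Finset.prod_mul_distrib, Finset.prod_mul_distrib]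
    ring
  simp only [hrw]
  rw [← Finset.mul_sum,
    sum_bool_prod fun i t => g (β i) i (!t) * boolSign t * g (β j) i t,
    Finset.prod_eq_zero (mem_univ j), mul_zero]
  simp [boolSign]
  ring

lemma dist_sq_cubePoint_const {n : ℕ} (a : Fin n → Bool) (t : ℝ) :
    dist (cubePoint a) (WithLp.toLp 2 fun _ => t) ^ 2 =
      n * t ^ 2 + (1 - 2 * t) * #{i | a i = true} := by
  have h : ∀ i, ((if a i = true then (1 : ℝ) else 0) - t) ^ 2 =
      t ^ 2 + (1 - 2 * t) * (if a i = true then 1 else 0) := by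
    intro i; split_ifs <;> ring
  rw [EuclideanSpace.dist_sq_eq]
  simp only [cubePoint, Real.dist_eq, sq_abs, h, Finset.sum_add_distrib, ← Finset.mul_sum]
  simp

lemma parityFn_eq_decide_odd {n : ℕ} (a : Fin n → Bool) :
    parityFn n a = decide (Odd #{i | a i = true}) := by
  have h : boolSign (parityFn n a) = (-1) ^ #{i | a i = true} := by
    rw [boolSign_parityFn]
    simp [boolSign, Finset.prod_ite]
  rcases Nat.even_or_odd #{i | a i = true} with hk | hk
  · rw [hk.neg_one_pow] at h
    have : ¬ Odd #{i | a i = true} := Nat.not_odd_iff_even.2 hk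
    cases hp : parityFn n a <;> simp_all [boolSign]
    norm_num at h
  · rw [hk.neg_one_pow] at h
    cases hp : parityFn n a <;> simp_all [boolSign]
    norm_num at h

/-- The diagonal points `(k / n, …, k / n)`, with `k` odd or even respectively, are the prototypes
of a representation of parity. -/
lemma nnComplexity_parityFn_le (n : ℕ) : nnComplexity (parityFn n) ≤ n + 1 := by
  let pt : ℕ → EuclideanSpace ℝ (Fin n) := fun k => WithLp.toLp 2 fun _ => (k : ℝ) / n
  let P := pt '' {k | k ≤ n ∧ Odd k}
  let N := pt '' {k | k ≤ n ∧ ¬ Odd k}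
  have hPN : P ∪ N = pt '' Set.Iic n := by
    rw [← Set.image_union]
    congr 1
    ext k
    simp only [Set.mem_union, Set.mem_ofPred_eq, Set.mem_Iic]
    tauto
  have hfin : (P ∪ N).Finite := hPN ▸ (Set.finite_Iic n).image pt
  have hclose : ∀ (a : Fin n → Bool) (k : ℕ), k ≤ n → k ≠ #{i | a i = true} →
      dist (cubePoint a) (pt #{i | a i = true}) < dist (cubePoint a) (pt k) := by
    intro a k hkn hk
    have hcn : #{i | a i = true} ≤ n := by simpa using Finset.card_le_univ {i | a i = true}
    have hn : 0 < n := by omega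
    have hn' : (0 : ℝ) < n := by exact_mod_cast hn
    refine lt_of_pow_lt_pow_left₀ 2 dist_nonneg ?_
    rw [dist_sq_cubePoint_const, dist_sq_cubePoint_const, ← sub_pos]
    set c := #{i | a i = true}
    have hne : (k : ℝ) - c ≠ 0 := sub_ne_zero.2 (by exact_mod_cast hk)
    have : (n * ((k : ℝ) / n) ^ 2 + (1 - 2 * ((k : ℝ) / n)) * c) -
        (n * ((c : ℝ) / n) ^ 2 + (1 - 2 * ((c : ℝ) / n)) * c) = ((k : ℝ) - c) ^ 2 / n := by
      field_simp
      ring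
    rw [this]
    positivity
  have hcard : (P ∪ N).ncard ≤ n + 1 := by
    rw [hPN]
    refine (Set.ncard_image_le (Set.finite_Iic n)).trans ?_
    rw [← Finset.coe_Iic, Set.ncard_coe_finset, Nat.card_Iic]
  suffices hrep : IsNNRepresentation (parityFn n) P N from
    (Nat.sInf_le (⟨P, N, hfin.subset Set.subset_union_left, hfin.subset Set.subset_union_right,
      hrep, rfl⟩ : (P ∪ N).ncard ∈ nnSizes (parityFn n))).trans hcard
  refine ⟨?_, ?_, ?_⟩
  · rw [Set.disjoint_left]
    rintro _ ⟨k, ⟨hkn, hk⟩, rfl⟩ ⟨l, ⟨hln, hl⟩, hkl⟩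
    have hn : 0 < n := hk.pos.trans_le hkn
    have h0 : (l : ℝ) / n = k / n := congrArg (fun v => v.ofLp ⟨0, hn⟩) hkl
    have hn' : (n : ℝ) ≠ 0 := by exact_mod_cast hn.ne'
    rw [div_left_inj' hn'] at h0
    exact hl ((Nat.cast_injective h0) ▸ hk)
  · intro a ha
    rw [parityFn_eq_decide_odd, decide_eq_true_eq] at ha
    refine ⟨_, ⟨_, ⟨by simpa using Finset.card_le_univ {i | a i = true}, ha⟩, rfl⟩, ?_⟩
    rintro _ ⟨k, ⟨hkn, hk⟩, rfl⟩
    exact hclose a k hkn fun h => hk (h ▸ ha)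
  · intro a ha
    rw [parityFn_eq_decide_odd, decide_eq_false_iff_not] at ha
    refine ⟨_, ⟨_, ⟨by simpa using Finset.card_le_univ {i | a i = true}, ha⟩, rfl⟩, ?_⟩
    rintro _ ⟨k, ⟨hkn, hk⟩, rfl⟩
    exact hclose a k hkn fun h => ha (h ▸ hk)

/-! ### Scaling a positive matrix -/

/-- The rows of a positive matrix can be rescaled so that, after normalization of the columns to
sum one, all rows have the same sum. The scaling maximizes a function which is continuous on the
simplex, vanishes on its boundary, and is homogeneous of degree zero. -/
lemma exists_scaling {B X : Type*} [Fintype B] [Fintype X] [Nonempty B] [Nonempty X]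
    (A : B → X → ℝ) (hA : ∀ b x, 0 < A b x) :
    ∃ l : B → ℝ, (∀ b, 0 < l b) ∧
      ∀ b, ∑ x, l b * A b x / ∑ c, l c * A c x = Fintype.card X / Fintype.card B := by
  classical
  set m := Fintype.card B
  set N := Fintype.card X
  have hm : 0 < m := Fintype.card_pos
  have hN : 0 < N := Fintype.card_pos
  let H : (B → ℝ) → ℝ := fun l => (∏ b, l b ^ N) / ∏ x, (∑ c, l c * A c x) ^ m
  have hS : ∀ l ∈ stdSimplex ℝ B, ∀ x, 0 < ∑ c, l c * A c x := by
    intro l hl x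
    obtain ⟨c, hc⟩ : ∃ c, 0 < l c := by
      by_contra! hc
      have := Finset.sum_nonpos fun c (_ : c ∈ univ) => hc c
      linarith [hl.2]
    exact Finset.sum_pos' (fun c _ => mul_nonneg (hl.1 c) (hA c x).le)
      ⟨c, mem_univ c, mul_pos hc (hA c x)⟩
  have hcont : ContinuousOn H (stdSimplex ℝ B) := by
    refine ContinuousOn.div (by fun_prop) (by fun_prop) fun l hl => ?_
    exact Finset.prod_ne_zero_iff.2 fun x _ => pow_ne_zero _ (hS l hl x).ne'
  obtain ⟨l, hl, hmax⟩ := (isCompact_stdSimplex ℝ B).exists_isMaxOn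
    ⟨_, single_mem_stdSimplex ℝ (Classical.arbitrary B)⟩ hcont
  have hHpos : ∀ l : B → ℝ, (∀ b, 0 < l b) → 0 < H l := by
    intro l hl
    refine div_pos (Finset.prod_pos fun b _ => pow_pos (hl b) _)
      (Finset.prod_pos fun x _ => pow_pos ?_ _)
    exact Finset.sum_pos (fun c _ => mul_pos (hl c) (hA c x)) univ_nonempty
  have hhom : ∀ (r : ℝ), 0 < r → ∀ l : B → ℝ, H (fun b => r * l b) = H l := by
    intro r hr l
    simp only [H, mul_assoc, ← Finset.mul_sum, mul_pow, Finset.prod_mul_distrib,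
      Finset.prod_const, Finset.card_univ, ← pow_mul]
    rw [mul_comm (Fintype.card X) m, mul_div_mul_left _ _ (by positivity)]
  have hglob : ∀ l' : B → ℝ, (∀ b, 0 < l' b) → H l' ≤ H l := by
    intro l' hl'
    have hs : 0 < ∑ b, l' b := Finset.sum_pos (fun b _ => hl' b) univ_nonempty
    rw [← hhom (∑ b, l' b)⁻¹ (inv_pos.2 hs) l']
    refine hmax ⟨fun b => (mul_pos (inv_pos.2 hs) (hl' b)).le, ?_⟩
    rw [← Finset.mul_sum, inv_mul_cancel₀ hs.ne']
  have hlpos : ∀ b, 0 < l b := by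
    intro b
    refine (hl.1 b).lt_of_ne fun h0 => ?_
    have h1 : H l = 0 := by
      simp only [H]
      rw [Finset.prod_eq_zero (mem_univ b) (by rw [← h0, zero_pow hN.ne']), zero_div]
    have h2 := hglob (fun _ => 1) (fun _ => one_pos)
    have h3 := hHpos (fun _ => 1) (fun _ => one_pos)
    linarith
  refine ⟨l, hlpos, fun b => ?_⟩
  let S : X → ℝ := fun x => ∑ c, l c * A c x
  have hSpos : ∀ x, 0 < S x := hS l hl
  -- the logarithm of `H` along the line through `l` in direction `b`
  let φ : ℝ → ℝ := fun t => N * ∑ c, Real.log (Function.update l b t c) -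
    m * ∑ x, Real.log (S x + (t - l b) * A b x)
  have hφ : ∀ t, 0 < t → φ t = Real.log (H (Function.update l b t)) := by
    intro t ht
    have hup : ∀ c, 0 < Function.update l b t c := by
      intro c
      rcases eq_or_ne c b with rfl | hc
      · simpa using ht
      · simpa [hc] using hlpos c
    have hSx : ∀ x, ∑ c, Function.update l b t c * A c x = S x + (t - l b) * A b x := by
      intro x
      have : ∀ c, Function.update l b t c * A c x =
          l c * A c x + (if c = b then (t - l b) * A b x else 0) := by
        intro c
        rcases eq_or_ne c b with rfl | hc
        · simp; ring
        · simp [hc]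
      simp [this, Finset.sum_add_distrib, S]
    have hSx' : ∀ x, 0 < S x + (t - l b) * A b x := fun x => by
      rw [← hSx x]
      exact Finset.sum_pos (fun c _ => mul_pos (hup c) (hA c x)) univ_nonempty
    simp only [H, hSx]
    rw [Real.log_div
      (Finset.prod_ne_zero_iff.2 fun c _ => pow_ne_zero _ (hup c).ne')
      (Finset.prod_ne_zero_iff.2 fun x _ => pow_ne_zero _ (hSx' x).ne'),
      Real.log_prod fun c _ => pow_ne_zero _ (hup c).ne',
      Real.log_prod fun x _ => pow_ne_zero _ (hSx' x).ne']
    simp only [Real.log_pow, ← Finset.mul_sum, φ]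
  have hloc : IsLocalMax φ (l b) := by
    filter_upwards [lt_mem_nhds (hlpos b)] with t ht
    have hup : ∀ c, 0 < Function.update l b t c := by
      intro c
      rcases eq_or_ne c b with rfl | hc
      · simpa using ht
      · simpa [hc] using hlpos c
    rw [hφ t ht, hφ _ (hlpos b), Function.update_eq_self]
    exact Real.log_le_log (hHpos _ hup) (hglob _ hup)
  have hderiv : HasDerivAt φ (N * (l b)⁻¹ - m * ∑ x, A b x / S x) (l b) := by
    have h1 : HasDerivAt (fun t => ∑ c, Real.log (Function.update l b t c)) (l b)⁻¹ (l b) := by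
      have : ∀ c ∈ univ, HasDerivAt (fun t => Real.log (Function.update l b t c))
          (if c = b then (l b)⁻¹ else 0) (l b) := by
        intro c _
        rcases eq_or_ne c b with rfl | hc
        · simpa using Real.hasDerivAt_log (hlpos c).ne'
        · simpa [hc] using hasDerivAt_const (l b) (Real.log (l c))
      simpa using HasDerivAt.fun_sum this
    have h2 : HasDerivAt (fun t => ∑ x, Real.log (S x + (t - l b) * A b x))
        (∑ x, A b x / S x) (l b) := by
      refine HasDerivAt.fun_sum fun x _ => ?_
      have h3 : HasDerivAt (fun t => S x + (t - l b) * A b x) (A b x) (l b) := by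
        simpa using ((((hasDerivAt_id (l b)).sub_const (l b)).mul_const (A b x)).const_add (S x))
      simpa using h3.log (by simpa using (hSpos x).ne')
    exact (h1.const_mul _).sub (h2.const_mul _)
  have hzero := hloc.hasDerivAt_eq_zero hderiv
  have hlb := (hlpos b).ne'
  have hm' : (m : ℝ) ≠ 0 := by exact_mod_cast hm.ne'
  change ∑ x, l b * A b x / S x = _
  simp only [mul_div_assoc, ← Finset.mul_sum]
  field_simp at hzero ⊢
  linarith

/-! ### The rank bound for positive weights -/

/-- The rank bound for weights in normal form. The number `C` bounds the square of the operator
norm of `M`. -/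
lemma card_sq_ge_of_normalized {B X Y : Type*} [Fintype B] [Fintype X] [Fintype Y] [Nonempty B]
    (M : X → Y → ℝ) {C δ : ℝ} (hδ : δ ≤ 1)
    (hM : ∀ (u : X → ℝ) (v : Y → ℝ),
      (∑ x, ∑ y, M x y * (u x * v y)) ^ 2 ≤ C * (∑ x, u x ^ 2) * ∑ y, v y ^ 2)
    (e : B → Bool) (p : B → X → ℝ) (q : B → Y → ℝ) (hp : ∀ b x, 0 ≤ p b x)
    (hq : ∀ b y, 0 ≤ q b y) (hp1 : ∀ x, ∑ b, p b x ^ 2 = 1) (hq1 : ∀ y, ∑ b, q b y ^ 2 = 1)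
    (hpX : ∀ b, ∑ x, p b x ^ 2 = Fintype.card X / Fintype.card B)
    (h : ∀ x y, (1 - δ) * ∑ b, p b x * q b y ≤
      M x y * ∑ b, boolSign (e b) * (p b x * q b y)) :
    ((1 - δ) * (Fintype.card X * Fintype.card Y)) ^ 2 ≤
      (Fintype.card B) ^ 2 * (C * (Fintype.card X * Fintype.card Y)) := by
  set m : ℝ := (Fintype.card B : ℝ)
  have hm : 0 < m := Nat.cast_pos.2 Fintype.card_pos
  let T : B → ℝ := fun b => ∑ x, ∑ y, M x y * (p b x * q b y)
  have hT : ∑ x, ∑ y, M x y * ∑ b, boolSign (e b) * (p b x * q b y) =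
      ∑ b, boolSign (e b) * T b := by
    simp only [T, Finset.mul_sum]
    rw [Finset.sum_comm' (t' := univ) (s' := fun _ => univ) (by simp)]
    rw [Finset.sum_comm]
    simp only [Finset.sum_comm (s := (univ : Finset Y)) (t := (univ : Finset B))]
    rw [Finset.sum_comm (s := (univ : Finset X)) (t := (univ : Finset B))]
    refine Finset.sum_congr rfl fun b _ => Finset.sum_congr rfl fun x _ =>
      Finset.sum_congr rfl fun y _ => by ring
  have hupper : (∑ b, boolSign (e b) * T b) ^ 2 ≤ C * (Fintype.card X * Fintype.card Y) := by
    calc (∑ b, boolSign (e b) * T b) ^ 2 ≤ m * ∑ b, (boolSign (e b) * T b) ^ 2 := by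
          simpa using sq_sum_le_card_mul_sum_sq (s := univ) (f := fun b => boolSign (e b) * T b)
      _ = m * ∑ b, T b ^ 2 := by
          congr 1
          refine Finset.sum_congr rfl fun b _ => ?_
          rw [mul_pow, sq (boolSign _), boolSign_mul_self, one_mul]
      _ ≤ m * ∑ b, C * (Fintype.card X / m) * ∑ y, q b y ^ 2 := by
          gcongr with b
          rw [← hpX b]
          exact hM (p b) (q b)
      _ = C * (Fintype.card X * Fintype.card Y) := by
          rw [← Finset.mul_sum, Finset.sum_comm]
          simp only [hq1, Finset.sum_const, Finset.card_univ, nsmul_eq_mul]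
          field_simp
  have hle1 : ∀ {r : B → ℝ}, ∑ b, r b ^ 2 = 1 → ∀ b, r b ≤ 1 := by
    intro r hr b
    have : r b ^ 2 ≤ 1 := hr ▸ Finset.single_le_sum (f := fun b => r b ^ 2)
      (fun b _ => sq_nonneg (r b)) (mem_univ b)
    exact (abs_le_one_iff_mul_self_le_one.2 (by rwa [← sq])) |> (le_abs_self _).trans
  have hlower : Fintype.card X * Fintype.card Y / m ≤ ∑ x, ∑ y, ∑ b, p b x * q b y := by
    calc (Fintype.card X * Fintype.card Y / m : ℝ)
        = ∑ b, (∑ x, p b x ^ 2) * ∑ y, q b y ^ 2 := by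
          simp only [hpX]
          rw [← Finset.mul_sum, Finset.sum_comm]
          simp only [hq1, Finset.sum_const, Finset.card_univ, nsmul_eq_mul]
          ring
      _ = ∑ x, ∑ y, ∑ b, p b x ^ 2 * q b y ^ 2 := by
          simp only [Finset.sum_mul_sum]
          rw [Finset.sum_comm]
          exact Finset.sum_congr rfl fun x _ => Finset.sum_comm
      _ ≤ _ := by
          gcongr with x _ y _ b _
          · exact hp b x
          · exact pow_le_of_le_one (hp b x) (hle1 (hp1 x) b) two_ne_zero
          · exact pow_le_of_le_one (hq b y) (hle1 (hq1 y) b) two_ne_zero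
  have hlow2 : (1 - δ) * (Fintype.card X * Fintype.card Y / m) ≤ ∑ b, boolSign (e b) * T b := by
    rw [← hT]
    refine (mul_le_mul_of_nonneg_left hlower (by linarith)).trans ?_
    simp only [Finset.mul_sum (a := 1 - δ)]
    gcongr with x _ y _
    simpa only [Finset.mul_sum (a := 1 - δ)] using h x y
  have h0 : 0 ≤ (1 - δ) * (Fintype.card X * Fintype.card Y / m : ℝ) :=
    mul_nonneg (by linarith) (by positivity)
  calc ((1 - δ) * (Fintype.card X * Fintype.card Y) : ℝ) ^ 2
      = m ^ 2 * ((1 - δ) * (Fintype.card X * Fintype.card Y / m)) ^ 2 := by field_simp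
    _ ≤ m ^ 2 * (C * (Fintype.card X * Fintype.card Y)) := by
        gcongr
        exact (pow_le_pow_left₀ h0 hlow2 2).trans hupper

/-- The rank bound for arbitrary positive weights, which diagonal scaling brings to normal form. -/
lemma card_sq_ge_of_pos {B X Y : Type*} [Fintype B] [Fintype X] [Fintype Y] [Nonempty B]
    [Nonempty X] (M : X → Y → ℝ) {C δ : ℝ} (hδ : δ ≤ 1)
    (hM : ∀ (u : X → ℝ) (v : Y → ℝ),
      (∑ x, ∑ y, M x y * (u x * v y)) ^ 2 ≤ C * (∑ x, u x ^ 2) * ∑ y, v y ^ 2)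
    (e : B → Bool) (p : B → X → ℝ) (q : B → Y → ℝ) (hp : ∀ b x, 0 < p b x)
    (hq : ∀ b y, 0 < q b y)
    (h : ∀ x y, (1 - δ) * ∑ b, p b x * q b y ≤
      M x y * ∑ b, boolSign (e b) * (p b x * q b y)) :
    ((1 - δ) * (Fintype.card X * Fintype.card Y)) ^ 2 ≤
      (Fintype.card B) ^ 2 * (C * (Fintype.card X * Fintype.card Y)) := by
  obtain ⟨l, hl, hsum⟩ := exists_scaling (fun b x => p b x ^ 2) fun b x => pow_pos (hp b x) 2
  let S : X → ℝ := fun x => ∑ c, l c * p c x ^ 2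
  let Q : Y → ℝ := fun y => ∑ c, q c y ^ 2 / l c
  have hS : ∀ x, 0 < S x := fun x =>
    Finset.sum_pos (fun c _ => mul_pos (hl c) (pow_pos (hp c x) 2)) univ_nonempty
  have hQ : ∀ y, 0 < Q y := fun y =>
    Finset.sum_pos (fun c _ => div_pos (pow_pos (hq c y) 2) (hl c)) univ_nonempty
  have hp2 : ∀ b x, (√(l b) * p b x / √(S x)) ^ 2 = l b * p b x ^ 2 / S x := fun b x => by
    rw [div_pow, mul_pow, Real.sq_sqrt (hl b).le, Real.sq_sqrt (hS x).le]
  have hq2 : ∀ b y, (q b y / √(l b) / √(Q y)) ^ 2 = q b y ^ 2 / l b / Q y := fun b y => by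
    rw [div_pow, div_pow, Real.sq_sqrt (hl b).le, Real.sq_sqrt (hQ y).le]
  refine card_sq_ge_of_normalized M hδ hM e (fun b x => √(l b) * p b x / √(S x))
    (fun b y => q b y / √(l b) / √(Q y)) ?_ ?_ ?_ ?_ ?_ ?_
  · intro b x
    have := hp b x
    positivity
  · intro b y
    have := hq b y
    positivity
  · intro x
    simp only [hp2]
    rw [← Finset.sum_div, div_self (hS x).ne']
  · intro y
    simp only [hq2]
    rw [← Finset.sum_div, div_self (hQ y).ne']
  · intro b
    simp only [hp2]
    exact hsum b
  · intro x y
    have hsS := Real.sqrt_pos.2 (hS x)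
    have hsQ := Real.sqrt_pos.2 (hQ y)
    -- the factors `√(l b)` cancel, so that every weight changes by the same factor
    have hpq : ∀ b, √(l b) * p b x / √(S x) * (q b y / √(l b) / √(Q y)) =
        (√(S x) * √(Q y))⁻¹ * (p b x * q b y) := by
      intro b
      have := Real.sqrt_pos.2 (hl b)
      field_simp
    have hpq' : ∀ b, boolSign (e b) * ((√(S x) * √(Q y))⁻¹ * (p b x * q b y)) =
        (√(S x) * √(Q y))⁻¹ * (boolSign (e b) * (p b x * q b y)) := fun b => mul_left_comm _ _ _
    simp only [hpq, hpq', ← Finset.mul_sum]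
    rw [mul_left_comm, mul_left_comm (M x y)]
    exact mul_le_mul_of_nonneg_left (h x y) (by positivity)

/-! ### The inner product function -/

/-- The columns of the sign matrix of the inner product function are orthogonal. -/
lemma sum_boolSign_and_mul {n : ℕ} (y z : Fin n → Bool) :
    ∑ x : Fin n → Bool, (∏ i, boolSign (x i && y i)) * ∏ i, boolSign (x i && z i) =
      if y = z then 2 ^ n else 0 := by
  simp only [← Finset.prod_mul_distrib]
  rw [sum_bool_prod fun i t => boolSign (t && y i) * boolSign (t && z i)]
  split_ifs with hyz
  · subst hyz
    simp only [boolSign_mul_self]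
    norm_num
  · obtain ⟨i, hi⟩ := Function.ne_iff.1 hyz
    refine Finset.prod_eq_zero (mem_univ i) ?_
    cases hy : y i <;> cases hz : z i <;> simp_all [boolSign]

/-- Lindsey's lemma: the operator norm of the sign matrix of the inner product function is at most
the square root of `2 ^ n`. -/
lemma sq_sum_boolSign_and_le {n : ℕ} (u v : (Fin n → Bool) → ℝ) :
    (∑ x, ∑ y, (∏ i, boolSign (x i && y i)) * (u x * v y)) ^ 2 ≤
      2 ^ n * (∑ x, u x ^ 2) * ∑ y, v y ^ 2 := by
  let M : (Fin n → Bool) → (Fin n → Bool) → ℝ := fun x y => ∏ i, boolSign (x i && y i)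
  have h1 : ∑ x, ∑ y, M x y * (u x * v y) = ∑ x, u x * ∑ y, M x y * v y := by
    simp only [Finset.mul_sum, mul_left_comm]
  have h2 : ∑ x, (∑ y, M x y * v y) ^ 2 = 2 ^ n * ∑ y, v y ^ 2 := by
    calc ∑ x, (∑ y, M x y * v y) ^ 2
        = ∑ x, ∑ y, ∑ z, v y * v z * (M x y * M x z) := by
          refine Finset.sum_congr rfl fun x _ => ?_
          rw [sq, Finset.sum_mul_sum]
          exact Finset.sum_congr rfl fun y _ => Finset.sum_congr rfl fun z _ => by ring
      _ = ∑ y, ∑ z, v y * v z * ∑ x, M x y * M x z := by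
          rw [Finset.sum_comm]
          refine Finset.sum_congr rfl fun y _ => ?_
          rw [Finset.sum_comm]
          simp only [Finset.mul_sum]
      _ = 2 ^ n * ∑ y, v y ^ 2 := by
          simp only [M, sum_boolSign_and_mul, mul_ite, mul_zero, Finset.sum_ite_eq, mem_univ,
            if_true, Finset.mul_sum]
          exact Finset.sum_congr rfl fun y _ => by ring
  change (∑ x, ∑ y, M x y * (u x * v y)) ^ 2 ≤ _
  rw [h1]
  refine (Finset.sum_mul_sq_le_sq_mul_sq _ _ _).trans (le_of_eq ?_)
  rw [h2]
  ring

lemma two_pow_le_sq_of_representation {n : ℕ} {P N : Set (EuclideanSpace ℝ (Fin n ⊕ Fin n))}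
    (h : IsNNRepresentation (innerProductFn n) P N) [Fintype ↥(P ∪ N)] :
    (2 : ℝ) ^ n ≤ (Fintype.card ↥(P ∪ N) : ℝ) ^ 2 := by
  have := h.nonempty
  have hbound : ∀ δ ∈ Set.Ioo (0 : ℝ) 1,
      (1 - δ) ^ 2 * 2 ^ n ≤ (Fintype.card ↥(P ∪ N) : ℝ) ^ 2 := by
    rintro δ ⟨hδ0, hδ1⟩
    obtain ⟨e, g, hg, hw⟩ := h.exists_product_weights hδ0
    have hr := card_sq_ge_of_pos (B := ↥(P ∪ N)) (X := Fin n → Bool) (Y := Fin n → Bool)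
      (fun x y => ∏ i, boolSign (x i && y i)) (C := 2 ^ n) hδ1.le
      sq_sum_boolSign_and_le e
      (fun b x => ∏ i, g b (Sum.inl i) (x i)) (fun b y => ∏ i, g b (Sum.inr i) (y i))
      (fun b x => Finset.prod_pos fun i _ => hg _ _ _)
      (fun b y => Finset.prod_pos fun i _ => hg _ _ _) (fun x y => by
        simpa [boolSign_innerProductFn] using hw (Sum.elim x y))
    simp only [Fintype.card_pi, Fintype.card_bool, Finset.prod_const, Finset.card_univ,
      Fintype.card_fin, Nat.cast_pow, Nat.cast_ofNat] at hr
    refine le_of_mul_le_mul_right (a := ((2 : ℝ) ^ n) ^ 3) ?_ (by positivity)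
    calc _ = ((1 - δ) * ((2 : ℝ) ^ n * 2 ^ n)) ^ 2 := by ring
      _ ≤ _ := hr
      _ = _ := by ring
  have hlim : Tendsto (fun δ : ℝ => (1 - δ) ^ 2 * (2 : ℝ) ^ n) (𝓝[>] 0) (𝓝 (2 ^ n)) := by
    have : Continuous fun δ : ℝ => (1 - δ) ^ 2 * (2 : ℝ) ^ n := by fun_prop
    simpa using (this.tendsto 0).mono_left nhdsWithin_le_nhds
  refine le_of_tendsto hlim ?_
  filter_upwards [Ioo_mem_nhdsGT (zero_lt_one' ℝ)] with δ hδ using hbound δ hδ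

theorem mainTheorem1 (n : ℕ) :
    (2 : ℝ) ^ ((n : ℝ) / 2) ≤ (nnComplexity (innerProductFn n) : ℝ) ∧
      n + 1 ≤ nnComplexity (parityFn n) ∧
      nnComplexity (parityFn n) ≤ n + 1 := by
  refine ⟨?_, ?_, nnComplexity_parityFn_le n⟩
  · obtain ⟨P, N, hP, hN, h, hcard⟩ := Nat.sInf_mem (nnSizes_nonempty (innerProductFn n))
    have := (hP.union hN).fintype
    rw [nnComplexity, ← hcard, ← Nat.card_coe_set_eq, Nat.card_eq_fintype_card]
    refine le_of_sq_le_sq ?_ (by positivity)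
    rw [← Real.rpow_natCast, ← Real.rpow_mul (by norm_num)]
    simpa using two_pow_le_sq_of_representation h
  · obtain ⟨P, N, hP, hN, h, hcard⟩ := Nat.sInf_mem (nnSizes_nonempty (parityFn n))
    have := (hP.union hN).fintype
    have := h.nonempty
    rw [nnComplexity, ← hcard, ← Nat.card_coe_set_eq, Nat.card_eq_fintype_card]
    obtain ⟨e, g, hg, hw⟩ := h.exists_product_weights (δ := 1 / 2) (by norm_num)
    refine card_gt_of_parity_weights (fun b => boolSign (e b)) g hg fun a =>
      lt_of_lt_of_le ?_ (hw a)
    refine mul_pos (by norm_num) (Finset.sum_pos (fun b _ => ?_) univ_nonempty)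
    exact Finset.prod_pos fun i _ => hg b i _
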